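/- Let $N\ge 0$ be the number of products and $T\ge 0$ the data size. The true discrete choice model is the single preference ranking $1\succ 2\succ\dots\succ N\succ 0$: from an assortment $S\subseteq\{1,\dots,N\}$ every customer chooses the smallest product in $S$, and the no-purchase option $0$ if $S=\emptyset$. The training data are $T$ independent observations $(i_t,S_t)$, where $S_t$ contains each product independently with probability $1/2$ and $i_t$ is the choice from $S_t$ under the true model. A single decision tree is grown on all $T$ observations (one tree, $B=1$; sub-sample size $z=T$ without replacement), with all products as candidates for each split ($m=N$) and terminal leaf size $l=1$. Starting from a single root leaf, as long as some leaf has at least $l$ observations and can be split, i.e. some product is contained in some but not in all of the assortments observed in this leaf, such a leaf is split according to the presence of a product that minimizes, among all products for which neither new leaf is empty, the Gini index $\sum_{j}\frac{t_j}{T}\sum_{k=0}^{N}\hat p_{jk}(1-\hat p_{jk})$ of the resulting partition $\{R_j\}$; here $t_j$ is the number of observations in $R_j$ and $\hat p_{jk}$ is the empirical frequency of choice $k$ in $R_j$. Ties are broken in an arbitrary, possibly random, way. Each final leaf is labelled with the choice of one of its observations, selected in an arbitrary, possibly random, way (with $0$ if there are no observations). The tree predicts, for an assortment $S$, the label of the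 leaf that contains $S$. Then for every $\epsilon\ge 2^{-N}$, with $k=\lceil\log_2(1/\epsilon)\rceil$ (and an empty sum if $k\le 0$), the tree predicts the true choice correctly for more than $(1-\epsilon)2^N$ of the $2^N$ assortments with probability at least $$1-\sum_{i=1}^{k}\left[13\exp\left(-\frac{T}{164\cdot 2^{i-1}}\right)+10(N-i-1)\exp\left(-\frac{T}{113\cdot 2^{i-1}}\right)\right].$$ -/

import Mathlib

open MeasureTheory ProbabilityTheory

noncomputable section

/-- A discrete choice model on `N` products. An assortment is a set of products; `none` is the
no-purchase option, and `prob i S` is the probability that `i` is chosen from the assortment `S`. -/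
structure DCM (N : ℕ) where
  prob : Option (Fin N) → Finset (Fin N) → ℝ
  nonneg : ∀ i S, 0 ≤ prob i S
  sum_eq_one : ∀ S, ∑ i, prob i S = 1
  eq_zero_of_notMem : ∀ (j : Fin N) (S : Finset (Fin N)), j ∉ S → prob (some j) S = 0

/-- The choice made from `S` under the ranking `1 ≻ 2 ≻ ⋯ ≻ N ≻ 0` (product `j` is the element
`j - 1` of `Fin N`): the smallest product in `S`, or no purchase if `S` is empty. -/
def rankingChoice {N : ℕ} (S : Finset (Fin N)) : Option (Fin N) :=
  if h : S.Nonempty then some (S.min' h) else none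

/-- The DCM in which every customer has the single ranking `1 ≻ 2 ≻ ⋯ ≻ N ≻ 0`. -/
def rankingDCM (N : ℕ) : DCM N where
  prob i S := if i = rankingChoice S then 1 else 0
  nonneg i S := by split_ifs <;> norm_num
  sum_eq_one S := by simp
  eq_zero_of_notMem j S hj := by
    rw [if_neg]
    intro h
    unfold rankingChoice at h
    split_ifs at h with hS
    exact hj (Option.some.inj h ▸ S.min'_mem hS)

/-- One data point: the choice of a customer and the assortment that was offered. -/
structure Observation (N : ℕ) where
  choice : Option (Fin N)
  assortment : Finset (Fin N)

instance (N : ℕ) : MeasurableSpace (Observation N) := ⊤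

/-- Training data of size `T` generated by the DCM `p` under uniform sampling of assortments: the
observations are independent; each offered assortment contains each product independently with
probability `1/2` (so each of the assortments has probability `(1/2)^N`); given the assortment, the
choice follows `p`. -/
structure IsUniformTrainingData {N T : ℕ} {Ω : Type*} [MeasurableSpace Ω] (p : DCM N)
    (P : Measure Ω) (D : Fin T → Ω → Observation N) : Prop where
  measurable : ∀ t, Measurable (D t)
  indep : iIndepFun D P
  law : ∀ (t : Fin T) (i : Option (Fin N)) (S : Finset (Fin N)),
    P.real {ω | D t ω = ⟨i, S⟩} = (1 / 2 : ℝ) ^ N * p.prob i S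

/-- Binary decision trees on assortments: each internal node tests whether a product is in the
assortment, each leaf carries a class label. -/
inductive DecisionTree (N : ℕ) where
  | leaf (c : Option (Fin N)) : DecisionTree N
  | node (j : Fin N) (absent present : DecisionTree N) : DecisionTree N

instance (N : ℕ) : MeasurableSpace (DecisionTree N) := ⊤

namespace DecisionTree

/-- The label that the tree assigns to an assortment. -/
def predict {N : ℕ} : DecisionTree N → Finset (Fin N) → Option (Fin N)
  | leaf c, _ => c
  | node j a b, S => if j ∈ S then b.predict S else a.predict S

end DecisionTree

section Cart

variable {N T : ℕ} (d : Fin T → Observation N)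

/-- The observations in `A` whose assortment does not contain product `j`. -/
def absentPart (A : Finset (Fin T)) (j : Fin N) : Finset (Fin T) :=
  {t ∈ A | j ∉ (d t).assortment}

/-- The observations in `A` whose assortment contains product `j`. -/
def presentPart (A : Finset (Fin T)) (j : Fin N) : Finset (Fin T) :=
  {t ∈ A | j ∈ (d t).assortment}

/-- The empirical frequency of class `k` among the observations in `A`. -/
def classFreq (A : Finset (Fin T)) (k : Option (Fin N)) : ℝ :=
  ({t ∈ A | (d t).choice = k}.card : ℝ) / A.card

/-- The contribution `(t_j / T) ∑ₖ p̂ⱼₖ (1 - p̂ⱼₖ)` to the Gini index of a region whose observations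
are those in `A`. -/
def giniTerm (A : Finset (Fin T)) : ℝ :=
  (A.card : ℝ) / T * ∑ k, classFreq d A k * (1 - classFreq d A k)

/-- The part of the Gini index that depends on the choice of the product `j` on which a leaf with
observations `A` is split: the contributions of the two new regions. The other regions of the
partition are untouched, so that their contributions are the same for all `j`. -/
def splitGini (A : Finset (Fin T)) (j : Fin N) : ℝ :=
  giniTerm d (absentPart d A j) + giniTerm d (presentPart d A j)

/-- A leaf with observations `A` can be split on product `j`: neither of the new leaves is empty. -/
def CanSplit (A : Finset (Fin T)) (j : Fin N) : Prop :=
  (absentPart d A j).Nonempty ∧ (presentPart d A j).Nonempty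

/-- `CartOutput d l A t`: the tree `t` is a possible result of growing a tree from a leaf with
observations `A`, with terminal leaf size `l` and with all products as candidates for each split.
A leaf with at least `l` observations that can be split is split on a product that minimizes the
Gini index (any minimizer, if there are several). A final leaf carries the choice of one of its
observations (any one of them), and the initial label `0` if it has none. -/
inductive CartOutput (l : ℕ) : Finset (Fin T) → DecisionTree N → Prop
  | leaf (A : Finset (Fin T)) (c : Option (Fin N))
      (final : ¬ (l ≤ A.card ∧ ∃ j, CanSplit d A j))
      (label : (∃ t ∈ A, (d t).choice = c) ∨ (A = ∅ ∧ c = none)) :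
      CartOutput l A (DecisionTree.leaf c)
  | node (A : Finset (Fin T)) (j : Fin N) (a b : DecisionTree N)
      (size : l ≤ A.card) (split : CanSplit d A j)
      (optimal : ∀ j', CanSplit d A j' → splitGini d A j ≤ splitGini d A j')
      (left : CartOutput l (absentPart d A j) a)
      (right : CartOutput l (presentPart d A j) b) :
      CartOutput l A (DecisionTree.node j a b)

end Cart

/-- The number of assortments `S` for which the label assigned by the tree is the choice that is
made from `S` with probability one under the DCM `p`. -/
def numCorrect {N : ℕ} (p : DCM N) (t : DecisionTree N) : ℕ :=
  Set.ncard {S : Finset (Fin N) | p.prob (t.predict S) S = 1}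

end

/-!
Call the leaf whose assortments contain none of the first `r` products the `r`-th spine leaf. If the
`r`-th spine leaf is split on the next product, for every `r < k`, then all observations with one of
the first `k` products end up in pure regions, in which the tree is always right. What remains is the
`k`-th spine leaf with `2 ^ (N - k)` assortments, and there the tree is right at least once, because
a label is the choice of an actual observation (or the choice from the empty assortment, if there is
no observation). Hence fewer than `2 ^ (N - k) ≤ ε * 2 ^ N` predictions are wrong
(`CartOutput.lt_numCorrect`).

Products are numbered from `0` as elements of `Fin N`, so that product `r` is the best one in the
`r`-th spine leaf. That the tree splits there on `r` is a matter of sample proportions. In the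
population the Gini index after this split is smaller by a fixed fraction of the leaf than after a
split on a later product `j`, since the split on `r` makes one half pure. It is enough to look
at the frequency of a single class in each region: merging the other classes bounds the Gini index
from below, dropping them bounds it from above. The comparison survives if the leaf is balanced with
respect to `r` up to `7/100`, and the halves cut out by `r` (without it) and by `j` (with it and
without it) are balanced up to `1/10` with respect to `r + 1` and `r` respectively
(`Favourable.splitGini_lt`).

Each balance condition says that two sums of independent indicators are positive, so that a Chernoff
bound for the exponential moment over all `T` observations applies directly, with no
conditioning on the number of observations in the leaf
(`IsUniformTrainingData.measureReal_card_le`). The leaf has probability `2 ^ (-r)` and the halves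
`2 ^ (-(r + 1))`, which gives `exp (-T / (113 * 2 ^ r))` for every single condition, and a union bound
finishes the proof.
-/

/-! ### Counting observations -/

section Counting

variable {N T : ℕ} (d : Fin T → Observation N)

/-- The number of observations whose assortment contains all products in `I` and none in `J`. -/
def tally (I J : Finset (Fin N)) : ℕ :=
  Finset.card {t | (d t).assortment ∈ Finset.Icc I Jᶜ}

/-- Among the observations whose assortment contains all of `I` and none of `J`, the fraction that
contains `j` lies strictly between `1/2 - δ` and `1/2 + δ`; written without division, so that for
`δ ≤ 1/2` the strict inequalities also say that both kinds of observations occur. -/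
def NearlyBalanced (δ : ℝ) (I J : Finset (Fin N)) (j : Fin N) : Prop :=
  (1 / 2 - δ) * (tally d (insert j I) J + tally d I (insert j J)) < tally d (insert j I) J ∧
  (1 / 2 - δ) * (tally d I (insert j J) + tally d (insert j I) J) < tally d I (insert j J)

/-- The sample proportions that make product `r` the best split of the leaf whose assortments
contain no product before `r`. In the first condition on `j` only `j = r + 1` matters; requiring it of
all `j` avoids a case distinction for the last product, and the union bound has room for it. -/
def Favourable (r : Fin N) : Prop :=
  NearlyBalanced d (7 / 100) ∅ (Finset.Iio r) r ∧ ∀ j, r < j →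
    NearlyBalanced d (1 / 10) ∅ (insert r (Finset.Iio r)) j ∧
    NearlyBalanced d (1 / 10) {j} (Finset.Iio r) r ∧
    NearlyBalanced d (1 / 10) ∅ (insert j (Finset.Iio r)) r

/-- The observations whose assortment contains none of the first `k` products. -/
def remaining (k : ℕ) : Finset (Fin T) :=
  {t | ∀ i : Fin N, i.val < k → i ∉ (d t).assortment}

theorem mem_remaining {k : ℕ} {t : Fin T} :
    t ∈ remaining d k ↔ ∀ i : Fin N, i.val < k → i ∉ (d t).assortment := by
  simp [remaining]

theorem remaining_zero : remaining d 0 = Finset.univ := by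
  ext t; simp [remaining]

theorem absentPart_remaining (r : Fin N) :
    absentPart d (remaining d r) r = remaining d (r + 1) := by
  ext t
  simp only [absentPart, Finset.mem_filter, mem_remaining]
  constructor
  · rintro ⟨h, hr⟩ i hi
    rcases Nat.lt_succ_iff_lt_or_eq.1 hi with h' | h'
    · exact h i h'
    · rwa [Fin.ext h']
  · exact fun h => ⟨fun i hi => h i (by omega), h r (by omega)⟩

theorem tally_eq_card {I J : Finset (Fin N)} {B : Finset (Fin T)}
    (h : ∀ t, t ∈ B ↔ (∀ i ∈ I, i ∈ (d t).assortment) ∧ ∀ i ∈ J, i ∉ (d t).assortment) :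
    tally d I J = B.card := by
  unfold tally
  congr 1
  ext t
  rw [h t]
  simp only [Finset.mem_filter, Finset.mem_univ, true_and, Finset.mem_Icc]
  refine and_congr Iff.rfl ⟨fun hs i hi hi' => ?_, fun hs i hi => ?_⟩
  · exact Finset.mem_compl.1 (hs hi') hi
  · exact Finset.mem_compl.2 fun hi' => hs i hi' hi

theorem rankingChoice_eq_some_iff {S : Finset (Fin N)} {r : Fin N} :
    rankingChoice S = some r ↔ r ∈ S ∧ ∀ i < r, i ∉ S := by
  unfold rankingChoice
  split_ifs with h
  · rw [Option.some_inj]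
    constructor
    · rintro rfl
      exact ⟨S.min'_mem h, fun i hi hiS => absurd (S.min'_le i hiS) (not_le.2 hi)⟩
    · rintro ⟨hr, hi⟩
      refine le_antisymm (S.min'_le r hr) ?_
      by_contra! hlt
      exact hi _ hlt (S.min'_mem h)
  · rw [Finset.not_nonempty_iff_eq_empty] at h
    simp [h]

end Counting

/-! ### Bounds for the Gini index -/

section Gini

variable {N T : ℕ} (d : Fin T → Observation N)

theorem classFreq_nonneg (A : Finset (Fin T)) (k : Option (Fin N)) : 0 ≤ classFreq d A k := by
  unfold classFreq; positivity

theorem sum_classFreq {A : Finset (Fin T)} (hA : A.Nonempty) : ∑ k, classFreq d A k = 1 := by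
  unfold classFreq
  rw [← Finset.sum_div, ← Nat.cast_sum,
    ← Finset.card_eq_sum_card_fiberwise (fun _ _ => Finset.mem_coe.2 (Finset.mem_univ _))]
  exact div_self (by exact_mod_cast hA.card_pos.ne')

theorem giniTerm_le (A : Finset (Fin T)) (k : Option (Fin N)) :
    giniTerm d A ≤ A.card / T * (1 - classFreq d A k ^ 2) := by
  rcases A.eq_empty_or_nonempty with rfl | hA
  · simp [giniTerm]
  unfold giniTerm
  refine mul_le_mul_of_nonneg_left ?_ (by positivity)
  have h : classFreq d A k ^ 2 ≤ ∑ i, classFreq d A i ^ 2 :=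
    Finset.single_le_sum (f := fun i => classFreq d A i ^ 2) (fun i _ => sq_nonneg _)
      (Finset.mem_univ k)
  have h1 := sum_classFreq d hA
  simp only [mul_sub, mul_one, Finset.sum_sub_distrib, h1, ← sq]
  linarith

/-- Merging all classes other than `k` into one does not increase the Gini index. -/
theorem le_giniTerm (A : Finset (Fin T)) (k : Option (Fin N)) :
    A.card / T * (2 * classFreq d A k * (1 - classFreq d A k)) ≤ giniTerm d A := by
  rcases A.eq_empty_or_nonempty with rfl | hA
  · simp [giniTerm]
  unfold giniTerm
  refine mul_le_mul_of_nonneg_left ?_ (by positivity)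
  have h1 := sum_classFreq d hA
  have hsplit := Finset.add_sum_erase Finset.univ (classFreq d A) (Finset.mem_univ k)
  rw [← Finset.add_sum_erase Finset.univ _ (Finset.mem_univ k)]
  have hle : ∑ i ∈ Finset.univ.erase k, classFreq d A i * classFreq d A k ≤
      ∑ i ∈ Finset.univ.erase k, classFreq d A i * (1 - classFreq d A i) := by
    refine Finset.sum_le_sum fun i hi => mul_le_mul_of_nonneg_left ?_ (classFreq_nonneg d A i)
    have := Finset.single_le_sum (f := classFreq d A) (fun i _ => classFreq_nonneg d A i) hi
    linarith
  rw [← Finset.sum_mul] at hle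
  have : ∑ i ∈ Finset.univ.erase k, classFreq d A i = 1 - classFreq d A k := by linarith
  rw [this] at hle
  linarith

theorem giniTerm_nonpos_of_pure {A : Finset (Fin T)} {c : Option (Fin N)}
    (h : ∀ t ∈ A, (d t).choice = c) : giniTerm d A ≤ 0 := by
  rcases A.eq_empty_or_nonempty with rfl | hA
  · simp [giniTerm]
  have h1 : classFreq d A c = 1 := by
    unfold classFreq
    rw [Finset.filter_true_of_mem h]
    exact div_self (by exact_mod_cast hA.card_pos.ne')
  simpa [h1] using giniTerm_le d A c

/-- If the observations of class `c` in a region are those with product `j`, then balance of the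
region with respect to `j` bounds the frequency of the class. -/
theorem classFreq_bounds {I J : Finset (Fin N)} {j : Fin N} {B : Finset (Fin T)}
    {c : Option (Fin N)} (hbal : NearlyBalanced d (1 / 10) I J j)
    (hB : ∀ t, t ∈ B ↔ (∀ i ∈ I, i ∈ (d t).assortment) ∧ ∀ i ∈ J, i ∉ (d t).assortment)
    (hc : ∀ t ∈ B, (d t).choice = c ↔ j ∈ (d t).assortment) :
    2 / 5 ≤ classFreq d B c ∧ classFreq d B c ≤ 3 / 5 := by
  have hu : tally d (insert j I) J = Finset.card {t ∈ B | (d t).choice = c} := by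
    refine tally_eq_card d fun t => ?_
    rw [Finset.mem_filter]
    constructor
    · rintro ⟨h1, h2⟩
      rw [Finset.forall_mem_insert]
      exact ⟨⟨(hc t h1).1 h2, ((hB t).1 h1).1⟩, ((hB t).1 h1).2⟩
    · rw [Finset.forall_mem_insert]
      rintro ⟨⟨h1, h2⟩, h3⟩
      exact ⟨(hB t).2 ⟨h2, h3⟩, (hc t ((hB t).2 ⟨h2, h3⟩)).2 h1⟩
  have hv : tally d I (insert j J) = Finset.card {t ∈ B | ¬ (d t).choice = c} := by
    refine tally_eq_card d fun t => ?_
    rw [Finset.mem_filter]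
    constructor
    · rintro ⟨h1, h2⟩
      rw [hc t h1] at h2
      rw [Finset.forall_mem_insert]
      exact ⟨((hB t).1 h1).1, h2, ((hB t).1 h1).2⟩
    · rw [Finset.forall_mem_insert]
      rintro ⟨h1, h2, h3⟩
      exact ⟨(hB t).2 ⟨h1, h3⟩, fun h => h2 ((hc t ((hB t).2 ⟨h1, h3⟩)).1 h)⟩
  have hsum : (B.card : ℝ) = (tally d (insert j I) J : ℝ) + tally d I (insert j J) := by
    rw [hu, hv, ← Nat.cast_add, Finset.card_filter_add_card_filter_not]
  obtain ⟨h1, h2⟩ := hbal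
  have hpos : (0 : ℝ) < B.card := by
    rw [hsum]
    have := (tally d (insert j I) J).cast_nonneg (α := ℝ)
    have := (tally d I (insert j J)).cast_nonneg (α := ℝ)
    linarith
  refine ⟨?_, ?_⟩
  · unfold classFreq
    rw [← hu, le_div_iff₀ hpos]
    linarith
  · unfold classFreq
    rw [← hu, div_le_iff₀ hpos]
    linarith

end Gini

/-! ### The optimal split -/

section Split

variable {N T : ℕ} {d : Fin T → Observation N}

theorem choice_eq_some_iff (hd : ∀ t, (d t).choice = rankingChoice (d t).assortment) {r : Fin N}
    {t : Fin T} (ht : t ∈ remaining d r) :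
    (d t).choice = some r ↔ r ∈ (d t).assortment := by
  rw [hd t, rankingChoice_eq_some_iff]
  exact and_iff_left fun i hi => (mem_remaining d).1 ht i hi

theorem Favourable.card_bounds {r : Fin N} (h : Favourable d r) :
    0 < (presentPart d (remaining d r) r).card ∧ 0 < (absentPart d (remaining d r) r).card ∧
    ((absentPart d (remaining d r) r).card : ℝ) ≤ 57 / 100 * (remaining d r).card := by
  have hu : tally d (insert r ∅) (Finset.Iio r) = (presentPart d (remaining d r) r).card := by
    refine tally_eq_card d fun t => ?_
    simp [presentPart, mem_remaining, and_comm]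
  have hv : tally d ∅ (insert r (Finset.Iio r)) = (absentPart d (remaining d r) r).card := by
    refine tally_eq_card d fun t => ?_
    rw [absentPart_remaining]
    simp [mem_remaining]
  have hs : ((remaining d r).card : ℝ) = (presentPart d (remaining d r) r).card +
      (absentPart d (remaining d r) r).card := by
    rw [← Nat.cast_add, presentPart, absentPart, Finset.card_filter_add_card_filter_not]
  obtain ⟨h1, h2⟩ := h.1
  rw [hu, hv] at h1 h2
  have hp : (0 : ℝ) ≤ (presentPart d (remaining d r) r).card := Nat.cast_nonneg _
  have ha : (0 : ℝ) ≤ (absentPart d (remaining d r) r).card := Nat.cast_nonneg _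
  refine ⟨?_, ?_, by linarith⟩
  · have : (0 : ℝ) < (presentPart d (remaining d r) r).card := by linarith
    exact_mod_cast this
  · have : (0 : ℝ) < (absentPart d (remaining d r) r).card := by linarith
    exact_mod_cast this

theorem Favourable.canSplit {r : Fin N} (h : Favourable d r) : CanSplit d (remaining d r) r :=
  ⟨Finset.card_pos.1 h.card_bounds.2.1, Finset.card_pos.1 h.card_bounds.1⟩

/-- With `n` observations in the leaf, splitting on `r` leaves a pure part and a part of size at most
`0.57 n` in which product `r + 1` has frequency at least `0.4`, hence Gini index at most
`0.57 n / T * (1 - 0.4 ^ 2) < 0.48 n / T`. Splitting on a later product `j` leaves two parts in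
which `r` has frequency between `0.4` and `0.6`, hence Gini index at least `0.48 n / T`. -/
theorem Favourable.splitGini_lt (hd : ∀ t, (d t).choice = rankingChoice (d t).assortment)
    {r j : Fin N} (hrj : r < j) (h : Favourable d r) :
    splitGini d (remaining d r) r < splitGini d (remaining d r) j := by
  obtain ⟨hpos, -, hcard⟩ := h.card_bounds
  have hn : (0 : ℝ) < (remaining d r).card :=
    Nat.cast_pos.2 (hpos.trans_le (Finset.card_filter_le _ _))
  have hT : (0 : ℝ) < T := by
    have := (remaining d r).card_le_univ
    rw [Fintype.card_fin] at this
    exact hn.trans_le (by exact_mod_cast this)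
  have hs1 : (r : ℕ) + 1 < N := lt_of_le_of_lt hrj j.isLt
  have hs : r < (⟨r + 1, hs1⟩ : Fin N) := Nat.lt_succ_self _
  have hpure : giniTerm d (presentPart d (remaining d r) r) ≤ 0 := by
    refine giniTerm_nonpos_of_pure d (c := some r) fun t ht => ?_
    rw [presentPart, Finset.mem_filter] at ht
    exact (choice_eq_some_iff hd ht.1).2 ht.2
  have habs : giniTerm d (absentPart d (remaining d r) r) ≤
      (absentPart d (remaining d r) r).card / T * (21 / 25) := by
    obtain ⟨hf, -⟩ := classFreq_bounds d (B := absentPart d (remaining d r) r)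
      (c := some (⟨r + 1, hs1⟩ : Fin N)) (h.2 _ hs).1
      (fun t => by
        rw [absentPart_remaining]
        simp [mem_remaining])
      (fun t ht => choice_eq_some_iff hd (by rw [absentPart_remaining] at ht; exact ht))
    refine (giniTerm_le d _ (some ⟨r + 1, hs1⟩)).trans
      (mul_le_mul_of_nonneg_left ?_ (by positivity))
    nlinarith
  have key : ∀ B : Finset (Fin T), 2 / 5 ≤ classFreq d B (some r) →
      classFreq d B (some r) ≤ 3 / 5 → B.card / T * (12 / 25) ≤ giniTerm d B := by
    intro B h1 h2
    refine le_trans (mul_le_mul_of_nonneg_left ?_ (by positivity)) (le_giniTerm d B (some r))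
    nlinarith
  have hpj : (presentPart d (remaining d r) j).card / T * (12 / 25) ≤
      giniTerm d (presentPart d (remaining d r) j) := by
    obtain ⟨h1, h2⟩ := classFreq_bounds d (B := presentPart d (remaining d r) j)
      (c := some r) (h.2 j hrj).2.1
      (fun t => by simp [presentPart, mem_remaining, and_comm])
      (fun t ht => choice_eq_some_iff hd (Finset.mem_filter.1 ht).1)
    exact key _ h1 h2
  have haj : (absentPart d (remaining d r) j).card / T * (12 / 25) ≤
      giniTerm d (absentPart d (remaining d r) j) := by
    obtain ⟨h1, h2⟩ := classFreq_bounds d (B := absentPart d (remaining d r) j)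
      (c := some r) (h.2 j hrj).2.2
      (fun t => by simp [absentPart, mem_remaining, and_comm])
      (fun t ht => choice_eq_some_iff hd (Finset.mem_filter.1 ht).1)
    exact key _ h1 h2
  have hsum : ((remaining d r).card : ℝ) = (presentPart d (remaining d r) j).card +
      (absentPart d (remaining d r) j).card := by
    rw [← Nat.cast_add, presentPart, absentPart, Finset.card_filter_add_card_filter_not]
  unfold splitGini
  calc _ ≤ ((absentPart d (remaining d r) r).card : ℝ) / T * (21 / 25) + 0 :=
        add_le_add habs hpure
    _ < ((remaining d r).card : ℝ) / T * (12 / 25) := by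
      rw [add_zero, div_mul_eq_mul_div, div_mul_eq_mul_div]
      exact div_lt_div_of_pos_right (by linarith) hT
    _ = ((absentPart d (remaining d r) j).card : ℝ) / T * (12 / 25) +
        ((presentPart d (remaining d r) j).card : ℝ) / T * (12 / 25) := by rw [hsum]; ring
    _ ≤ _ := add_le_add haj hpj

/-- A product before `r` cannot split the leaf, and a later product is worse than `r`. -/
theorem Favourable.eq_of_optimal (hd : ∀ t, (d t).choice = rankingChoice (d t).assortment)
    {r j : Fin N} (h : Favourable d r) (hj : CanSplit d (remaining d r) j)
    (hopt : ∀ j', CanSplit d (remaining d r) j' →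
      splitGini d (remaining d r) j ≤ splitGini d (remaining d r) j') : j = r := by
  rcases lt_trichotomy j r with hlt | heq | hgt
  · obtain ⟨t, ht⟩ := hj.2
    rw [presentPart, Finset.mem_filter] at ht
    exact absurd ht.2 ((mem_remaining d).1 ht.1 j hlt)
  · exact heq
  · exact absurd (hopt r h.canSplit) (not_le.2 (h.splitGini_lt hd hgt))

end Split

/-! ### Predictions of the tree -/

section Tree

variable {N T : ℕ} {d : Fin T → Observation N} {l : ℕ}

theorem CartOutput.predict_of_pure {A : Finset (Fin T)} {tr : DecisionTree N}
    (h : CartOutput d l A tr) {c : Option (Fin N)} (hA : A.Nonempty)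
    (hc : ∀ t ∈ A, (d t).choice = c) (S : Finset (Fin N)) : tr.predict S = c := by
  induction h with
  | leaf A c' final label =>
    rcases label with ⟨t, ht, rfl⟩ | ⟨rfl, -⟩
    · exact hc t ht
    · exact absurd hA Finset.not_nonempty_empty
  | node A j a b size split optimal left right ihl ihr =>
    rw [DecisionTree.predict]
    split_ifs
    · exact ihr split.2 fun t ht => hc t (Finset.mem_filter.1 ht).1
    · exact ihl split.1 fun t ht => hc t (Finset.mem_filter.1 ht).1

/-- The label of a leaf is the choice of one of its observations, so that the tree is right about
the assortment of that observation. -/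
theorem CartOutput.exists_predict_eq {A : Finset (Fin T)} {tr : DecisionTree N}
    (h : CartOutput d l A tr) (hA : A.Nonempty) :
    ∃ t ∈ A, tr.predict (d t).assortment = (d t).choice := by
  induction h with
  | leaf A c final label =>
    rcases label with ⟨t, ht, rfl⟩ | ⟨rfl, -⟩
    · exact ⟨t, ht, rfl⟩
    · exact absurd hA Finset.not_nonempty_empty
  | node A j a b size split optimal left right ihl ihr =>
    obtain ⟨t, ht, he⟩ := ihr split.2
    rw [presentPart, Finset.mem_filter] at ht
    exact ⟨t, ht.1, by rw [DecisionTree.predict, if_pos ht.2, he]⟩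

theorem CartOutput.eq_leaf_of_empty {tr : DecisionTree N} (h : CartOutput d l ∅ tr) :
    tr = DecisionTree.leaf none := by
  cases h with
  | leaf _ c final label =>
    rcases label with ⟨t, ht, -⟩ | ⟨-, rfl⟩
    · exact absurd ht (Finset.notMem_empty t)
    · rfl
  | node _ j a b size split optimal left right =>
    obtain ⟨t, ht⟩ := split.1
    exact absurd (Finset.mem_filter.1 ht).1 (Finset.notMem_empty t)

/-- The assortments without the first `k` products for which the tree is wrong. -/
def wrong (tr : DecisionTree N) (k : ℕ) : Finset (Finset (Fin N)) :=
  {S | (∀ i : Fin N, i.val < k → i ∉ S) ∧ tr.predict S ≠ rankingChoice S}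

theorem card_without_first {k : ℕ} (hk : k ≤ N) :
    Finset.card {S : Finset (Fin N) | ∀ i : Fin N, i.val < k → i ∉ S} = 2 ^ (N - k) := by
  have h : ({S : Finset (Fin N) | ∀ i : Fin N, i.val < k → i ∉ S} : Finset (Finset (Fin N))) =
      ({i : Fin N | i.val < k} : Finset (Fin N))ᶜ.powerset := by
    ext S
    simp only [Finset.mem_filter, Finset.mem_univ, true_and, Finset.mem_powerset]
    exact ⟨fun h i hi => by simpa using fun hik => h i hik hi,
      fun h i hi hiS => absurd hi (by simpa using h hiS)⟩
  rw [h, Finset.card_powerset, Finset.card_compl, Fintype.card_fin, Fin.card_filter_val_lt,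
    min_eq_right hk]

theorem CartOutput.card_wrong_lt_self (hd : ∀ t, (d t).choice = rankingChoice (d t).assortment)
    {k : ℕ} (hk : k ≤ N) {tr : DecisionTree N} (h : CartOutput d l (remaining d k) tr) :
    (wrong tr k).card < 2 ^ (N - k) := by
  rw [← card_without_first hk]
  refine Finset.card_lt_card ⟨fun S hS => ?_, fun hsub => ?_⟩
  · simp only [wrong, Finset.mem_filter, Finset.mem_univ, true_and] at hS ⊢
    exact hS.1
  · simp only [wrong] at hsub
    rcases (remaining d k).eq_empty_or_nonempty with h0 | h0
    · rw [h0] at h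
      have := h.eq_leaf_of_empty
      subst this
      have := @hsub ∅ (by simp)
      simp [DecisionTree.predict, rankingChoice] at this
    · obtain ⟨t, ht, he⟩ := h.exists_predict_eq h0
      have := @hsub (d t).assortment (by simpa using (mem_remaining d).1 ht)
      simp only [Finset.mem_filter] at this
      exact this.2.2 (by rw [he, hd])

/-- A tree grown from the leaf without the first `r` products splits in turn on the products
`r, …, k - 1`, and is right about all assortments that contain one of them. -/
theorem CartOutput.card_wrong_lt (hd : ∀ t, (d t).choice = rankingChoice (d t).assortment)
    {k : ℕ} (hk : k ≤ N) {r : ℕ} (hr : r ≤ k)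
    (hfav : ∀ i : Fin N, r ≤ i.val → i.val < k → Favourable d i) {tr : DecisionTree N}
    (h : CartOutput d 1 (remaining d r) tr) : (wrong tr r).card < 2 ^ (N - k) := by
  induction hr using Nat.decreasingInduction generalizing tr with
  | self => exact h.card_wrong_lt_self hd hk
  | of_succ r hr ih =>
    obtain ⟨i, rfl⟩ : ∃ i : Fin N, i.val = r := ⟨⟨r, by omega⟩, rfl⟩
    have hf := hfav i le_rfl (by omega)
    generalize hA : remaining d i = A at h
    cases h with
    | leaf _ c final label =>
      subst hA
      exact absurd ⟨(hf.canSplit.1.mono (Finset.filter_subset _ _)).card_pos, i, hf.canSplit⟩ final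
    | node _ j a b size split optimal left right =>
      subst hA
      obtain rfl := hf.eq_of_optimal hd split optimal
      rw [absentPart_remaining] at left
      have hb : ∀ S, b.predict S = some j := right.predict_of_pure split.2 fun t ht =>
        (choice_eq_some_iff hd (Finset.mem_filter.1 ht).1).2 (Finset.mem_filter.1 ht).2
      refine lt_of_le_of_lt (Finset.card_le_card fun S hS => ?_)
        (ih (fun i hi => hfav i (by omega)) left)
      simp only [wrong, Finset.mem_filter, Finset.mem_univ, true_and] at hS ⊢
      obtain ⟨h1, h2⟩ := hS
      have hjS : j ∉ S := by
        intro hjS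
        rw [DecisionTree.predict, if_pos hjS, hb] at h2
        exact h2 (rankingChoice_eq_some_iff.2 ⟨hjS, fun i hi => h1 i hi⟩).symm
      rw [DecisionTree.predict, if_neg hjS] at h2
      refine ⟨fun i hi => ?_, h2⟩
      rcases Nat.lt_succ_iff_lt_or_eq.1 hi with h' | h'
      · exact h1 i h'
      · rwa [Fin.ext h']

theorem numCorrect_add_card_wrong (tr : DecisionTree N) :
    numCorrect (rankingDCM N) tr + (wrong tr 0).card = 2 ^ N := by
  have h : {S : Finset (Fin N) | (rankingDCM N).prob (tr.predict S) S = 1} =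
      (({S | tr.predict S = rankingChoice S} : Finset (Finset (Fin N))) : Set _) := by
    ext S
    by_cases h : tr.predict S = rankingChoice S <;> simp [rankingDCM, h]
  have hw : wrong tr 0 = ({S | ¬ tr.predict S = rankingChoice S} : Finset _) := by
    ext S; simp [wrong]
  rw [numCorrect, h, Set.ncard_coe_finset, hw, Finset.card_filter_add_card_filter_not,
    Finset.card_univ, Fintype.card_finset, Fintype.card_fin]

theorem CartOutput.lt_numCorrect (hd : ∀ t, (d t).choice = rankingChoice (d t).assortment)
    {k : ℕ} (hk : k ≤ N) (hfav : ∀ i : Fin N, i.val < k → Favourable d i) {tr : DecisionTree N}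
    (h : CartOutput d 1 Finset.univ tr) {ε : ℝ} (hε : (1 / 2 : ℝ) ^ k ≤ ε) :
    (1 - ε) * 2 ^ N < (numCorrect (rankingDCM N) tr : ℝ) := by
  rw [← remaining_zero d] at h
  have h1 := h.card_wrong_lt hd hk (Nat.zero_le k) fun i _ => hfav i
  have h2 := numCorrect_add_card_wrong tr
  have h1' : ((wrong tr 0).card : ℝ) < 2 ^ (N - k) := by exact_mod_cast h1
  have h2' : (numCorrect (rankingDCM N) tr : ℝ) + (wrong tr 0).card = 2 ^ N := by exact_mod_cast h2
  have h3 : (1 / 2 : ℝ) ^ k * 2 ^ N = 2 ^ (N - k) := by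
    rw [← Nat.sub_add_cancel hk, pow_add, mul_left_comm, ← mul_pow]
    simp
  have h4 := mul_le_mul_of_nonneg_right hε (by positivity : (0 : ℝ) ≤ 2 ^ N)
  linarith

end Tree

/-! ### Probability of unfavourable sample proportions -/

section Probability

variable {N T : ℕ} {Ω : Type*} [MeasurableSpace Ω] {P : Measure Ω} [IsProbabilityMeasure P]
  {D : Fin T → Ω → Observation N}

theorem IsUniformTrainingData.measurableSet_mem {p : DCM N} {P : Measure Ω}
    (hD : IsUniformTrainingData p P D) (t : Fin T) (s : Set (Observation N)) :
    MeasurableSet {ω | D t ω ∈ s} :=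
  hD.measurable t (show MeasurableSet s from MeasurableSpace.measurableSet_top)

/-- The observations `(choice from S, S)` have probability `2 ^ (-N)` each, so that they exhaust the
sample space up to a null set. -/
theorem IsUniformTrainingData.ae_choice_eq (hD : IsUniformTrainingData (rankingDCM N) P D) :
    ∀ᵐ ω ∂P, ∀ t, (D t ω).choice = rankingChoice (D t ω).assortment := by
  rw [ae_all_iff]
  intro t
  have hU : P.real (⋃ S ∈ (Finset.univ : Finset (Finset (Fin N))),
      {ω | D t ω = ⟨rankingChoice S, S⟩}) = 1 := by
    rw [measureReal_biUnion_finset]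
    · simp only [hD.law, rankingDCM, if_true, Finset.sum_const, Finset.card_univ,
        Fintype.card_finset, Fintype.card_fin, nsmul_eq_mul]
      push_cast
      rw [mul_one, ← mul_pow]
      norm_num
    · intro S _ S' _ hne
      refine Set.disjoint_left.2 fun ω h h' => hne ?_
      have := h.symm.trans h'
      injection this
    · exact fun S _ => hD.measurableSet_mem t {⟨rankingChoice S, S⟩}
  have h1 : P (⋃ S ∈ (Finset.univ : Finset (Finset (Fin N))),
      {ω | D t ω = ⟨rankingChoice S, S⟩}) = 1 := by
    rw [← ENNReal.toReal_eq_one_iff]; exact hU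
  have hmeas : MeasurableSet (⋃ S ∈ (Finset.univ : Finset (Finset (Fin N))),
      {ω | D t ω = ⟨rankingChoice S, S⟩}) :=
    Finset.measurableSet_biUnion _ fun S _ => hD.measurableSet_mem t {⟨rankingChoice S, S⟩}
  filter_upwards [(mem_ae_iff_prob_eq_one hmeas).2 h1] with ω hω
  simp only [Set.mem_iUnion, Set.mem_ofPred_eq] at hω
  obtain ⟨S, -, hS⟩ := hω
  rw [hS]

theorem IsUniformTrainingData.measureReal_assortment_mem
    (hD : IsUniformTrainingData (rankingDCM N) P D) (t : Fin T) (F : Finset (Finset (Fin N))) :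
    P.real {ω | (D t ω).assortment ∈ F} = F.card / 2 ^ N := by
  have hae : {ω | (D t ω).assortment ∈ F} =ᵐ[P]
      (⋃ S ∈ F, {ω | D t ω = ⟨rankingChoice S, S⟩} : Set Ω) := by
    filter_upwards [hD.ae_choice_eq] with ω hω
    have h : D t ω = ⟨rankingChoice (D t ω).assortment, (D t ω).assortment⟩ := by
      rw [← hω t]
    refine propext ⟨fun hF => ?_, fun hF => ?_⟩
    · exact Set.mem_biUnion (Finset.mem_coe.2 hF) h
    · obtain ⟨S, hS, he⟩ := Set.mem_iUnion₂.1 hF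
      have he : D t ω = ⟨rankingChoice S, S⟩ := he
      change (D t ω).assortment ∈ F
      rw [he]
      exact hS
  rw [measureReal_congr hae, measureReal_biUnion_finset]
  · simp only [hD.law, rankingDCM, if_true, Finset.sum_const, nsmul_eq_mul]
    rw [mul_one, one_div, inv_pow, div_eq_mul_inv]
  · intro S _ S' _ hne
    refine Set.disjoint_left.2 fun ω h h' => hne ?_
    have := h.symm.trans h'
    injection this
  · exact fun S _ => hD.measurableSet_mem t {⟨rankingChoice S, S⟩}

/-- The exponential moment of a fair coin that shows a bias of `δ`, at the optimal parameter. -/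
theorem exp_add_exp_le (δ : ℝ) :
    Real.exp (4 * δ * (1 / 2 - δ) - 4 * δ) + Real.exp (4 * δ * (1 / 2 - δ)) ≤
      2 * Real.exp (-(2 * δ ^ 2)) := by
  have h := Real.cosh_le_exp_half_sq (2 * δ)
  rw [Real.cosh_eq] at h
  have e1 : 4 * δ * (1 / 2 - δ) - 4 * δ = -(2 * δ) + -(4 * δ ^ 2) := by ring
  have e2 : 4 * δ * (1 / 2 - δ) = 2 * δ + -(4 * δ ^ 2) := by ring
  have e3 : -(2 * δ ^ 2) = (2 * δ) ^ 2 / 2 + -(4 * δ ^ 2) := by ring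
  rw [e1, e2, e3, Real.exp_add, Real.exp_add, Real.exp_add]
  have := mul_le_mul_of_nonneg_right h (Real.exp_pos (-(4 * δ ^ 2))).le
  linarith

/-- Chernoff bound: if the assortments in two disjoint families `U` and `V` are equally many, then
the fraction of `U` among the observations in `U ∪ V` is unlikely to be at most `1/2 - δ`. -/
theorem IsUniformTrainingData.measureReal_card_le
    (hD : IsUniformTrainingData (rankingDCM N) P D) {U V : Finset (Finset (Fin N))}
    (hUV : Disjoint U V) (hcard : U.card = V.card) {δ : ℝ} (hδ : 0 ≤ δ) :
    P.real {ω | (Finset.card {t | (D t ω).assortment ∈ U} : ℝ) ≤ (1 / 2 - δ) *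
        (Finset.card {t | (D t ω).assortment ∈ U} + Finset.card {t | (D t ω).assortment ∈ V})} ≤
      Real.exp (-(T * (2 * U.card / 2 ^ N * (1 - Real.exp (-(2 * δ ^ 2)))))) := by
  set s := 4 * δ * (1 / 2 - δ) with hs
  -- The statistic `(1/2 - δ) * #(U ∪ V) - #U`, scaled by `4 δ`, observation by observation.
  let g : Observation N → ℝ := fun o =>
    s * ((if o.assortment ∈ U then 1 else 0) + (if o.assortment ∈ V then 1 else 0)) -
      4 * δ * (if o.assortment ∈ U then 1 else 0)
  have hg : Measurable g := measurable_from_top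
  have hmeasF : ∀ (t : Fin T) (F : Finset (Finset (Fin N))),
      MeasurableSet {ω | (D t ω).assortment ∈ F} := fun t F =>
    hD.measurableSet_mem t {o | o.assortment ∈ F}
  let X : Fin T → Ω → ℝ := fun t => g ∘ D t
  have hX : ∀ t, Measurable (X t) := fun t => hg.comp (hD.measurable t)
  have hind : iIndepFun X P := hD.indep.comp (fun _ => g) fun _ => hg
  have hexp : ∀ t ω, Real.exp (1 * X t ω) = 1 +
      ({ω | (D t ω).assortment ∈ U}.indicator (fun _ => Real.exp (s - 4 * δ) - 1) ω +
        {ω | (D t ω).assortment ∈ V}.indicator (fun _ => Real.exp s - 1) ω) := by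
    intro t ω
    by_cases h1 : (D t ω).assortment ∈ U
    · have h2 := Finset.disjoint_left.1 hUV h1
      simp [X, g, h1, h2]
    · by_cases h2 : (D t ω).assortment ∈ V <;> simp [X, g, h1, h2]
  have hint : ∀ t, Integrable (fun ω => Real.exp (1 * X t ω)) P := by
    intro t
    simp only [hexp]
    exact (integrable_const _).add (((integrable_const _).indicator (hmeasF t U)).add
      ((integrable_const _).indicator (hmeasF t V)))
  have hmgf : ∀ t, mgf (X t) P 1 ≤
      Real.exp (-(2 * U.card / 2 ^ N * (1 - Real.exp (-(2 * δ ^ 2))))) := by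
    intro t
    have hval : mgf (X t) P 1 = 1 + (U.card / 2 ^ N * (Real.exp (s - 4 * δ) - 1) +
        U.card / 2 ^ N * (Real.exp s - 1)) := by
      unfold mgf
      simp only [hexp]
      rw [integral_add (integrable_const _) (((integrable_const _).indicator (hmeasF t U)).add
        ((integrable_const _).indicator (hmeasF t V))),
        integral_add ((integrable_const _).indicator (hmeasF t U))
        ((integrable_const _).indicator (hmeasF t V)), integral_indicator_const _ (hmeasF t U),
        integral_indicator_const _ (hmeasF t V), hD.measureReal_assortment_mem,
        hD.measureReal_assortment_mem, ← hcard]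
      simp
    have hle := mul_le_mul_of_nonneg_left (exp_add_exp_le δ)
      (by positivity : (0 : ℝ) ≤ U.card / 2 ^ N)
    rw [hval]
    refine le_trans ?_ (Real.add_one_le_exp _)
    rw [← hs] at hle
    have : 2 * (U.card : ℝ) / 2 ^ N = 2 * (U.card / 2 ^ N) := by ring
    rw [this]
    linarith
  have hsum : ∀ ω, (∑ t, X t) ω = s * (Finset.card {t | (D t ω).assortment ∈ U} +
      Finset.card {t | (D t ω).assortment ∈ V}) -
        4 * δ * Finset.card {t | (D t ω).assortment ∈ U} := by
    intro ω
    simp only [Finset.sum_apply, X, g, Function.comp_apply, Finset.sum_sub_distrib,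
      ← Finset.mul_sum, Finset.sum_add_distrib, Finset.sum_boole]
  have hmain := measure_ge_le_exp_mul_mgf (X := ∑ t, X t) (μ := P) 0 zero_le_one
    (hind.integrable_exp_mul_sum hX fun t _ => hint t)
  rw [mul_zero, Real.exp_zero, one_mul, hind.mgf_sum hX] at hmain
  refine (measureReal_mono fun ω hω => ?_).trans (hmain.trans ?_)
  · simp only [Set.mem_ofPred_eq] at hω ⊢
    rw [hsum, hs]
    have := mul_le_mul_of_nonneg_left hω (by linarith : (0 : ℝ) ≤ 4 * δ)
    linarith
  · refine (Finset.prod_le_prod (fun t _ => mgf_nonneg) fun t _ => hmgf t).trans ?_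
    rw [Finset.prod_const, Finset.card_univ, Fintype.card_fin, ← Real.exp_nat_mul, mul_neg]

theorem IsUniformTrainingData.measureReal_not_nearlyBalanced
    (hD : IsUniformTrainingData (rankingDCM N) P D) {δ : ℝ} (hδ : 0 ≤ δ) {I J : Finset (Fin N)}
    {j : Fin N} (hIJ : Disjoint I J) (hI : j ∉ I) (hJ : j ∉ J) :
    P.real {ω | ¬ NearlyBalanced (fun t => D t ω) δ I J j} ≤
      2 * Real.exp (-(T * ((1 - Real.exp (-(2 * δ ^ 2))) / 2 ^ (I.card + J.card)))) := by
  set U := Finset.Icc (insert j I) Jᶜ with hU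
  set V := Finset.Icc I (insert j J)ᶜ with hV
  have hIJ' : I ⊆ Jᶜ := Finset.subset_compl_iff_disjoint_right.2 hIJ
  have hUV : Disjoint U V := by
    refine Finset.disjoint_left.2 fun S h1 h2 => ?_
    have h1 := (Finset.mem_Icc.1 h1).1 (Finset.mem_insert_self j I)
    exact Finset.mem_compl.1 ((Finset.mem_Icc.1 h2).2 h1) (Finset.mem_insert_self j J)
  have hJN : J.card + I.card + 1 ≤ N := by
    have := Finset.card_le_univ (insert j (J ∪ I))
    rw [Finset.card_insert_of_notMem (by simp [hI, hJ]), Finset.card_union_of_disjoint hIJ.symm,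
      Fintype.card_fin] at this
    exact this
  have hUc : U.card = 2 ^ (N - J.card - (I.card + 1)) := by
    rw [hU, Finset.card_Icc_finset, Finset.card_compl, Fintype.card_fin,
      Finset.card_insert_of_notMem hI]
    exact Finset.insert_subset (Finset.mem_compl.2 hJ) hIJ'
  have hVc : V.card = 2 ^ (N - (J.card + 1) - I.card) := by
    rw [hV, Finset.card_Icc_finset, Finset.card_compl, Fintype.card_fin,
      Finset.card_insert_of_notMem hJ]
    rw [Finset.subset_compl_iff_disjoint_right, Finset.disjoint_insert_right]
    exact ⟨hI, hIJ⟩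
  have hcard : U.card = V.card := by
    rw [hUc, hVc]
    congr 1
    omega
  have hw : 2 * (U.card : ℝ) / 2 ^ N = 1 / 2 ^ (I.card + J.card) := by
    have hN : N = (N - J.card - (I.card + 1)) + 1 + (I.card + J.card) := by omega
    rw [div_eq_div_iff (by positivity) (by positivity), hUc]
    conv_rhs => rw [hN]
    push_cast
    ring
  have h1 := hD.measureReal_card_le hUV hcard hδ
  have h2 := hD.measureReal_card_le hUV.symm hcard.symm hδ
  rw [← hcard] at h2
  rw [hw, one_div_mul_eq_div] at h1 h2
  refine le_trans (measureReal_mono fun ω hω => ?_)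
    ((measureReal_union_le _ _).trans ((add_le_add h1 h2).trans_eq (two_mul _).symm))
  simp only [NearlyBalanced, tally, Set.mem_ofPred_eq, not_and_or, not_lt] at hω
  exact hω

theorem le_one_sub_exp_neg {c y : ℝ} (hy : 0 ≤ y) (h : c * (1 + y) ≤ y) :
    c ≤ 1 - Real.exp (-y) := by
  have h1 : Real.exp (-y) ≤ 1 / (1 + y) := by
    rw [Real.exp_neg, ← one_div]
    exact one_div_le_one_div_of_le (by linarith) (by linarith [Real.add_one_le_exp y])
  have h2 : c ≤ y / (1 + y) := (le_div_iff₀ (by linarith)).2 h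
  have h3 : y / (1 + y) = 1 - 1 / (1 + y) := by field_simp; ring
  linarith

theorem IsUniformTrainingData.measureReal_not_favourable
    (hD : IsUniformTrainingData (rankingDCM N) P D) (r : Fin N) :
    P.real {ω | ¬ Favourable (fun t => D t ω) r} ≤
      (2 + 6 * ((N : ℝ) - r - 1)) * Real.exp (-(T : ℝ) / (113 * 2 ^ (r : ℕ))) := by
  set E := Real.exp (-(T : ℝ) / (113 * 2 ^ (r : ℕ))) with hE
  have hexp : ∀ {c : ℝ}, 1 / (113 * 2 ^ (r : ℕ)) ≤ c → Real.exp (-(T * c)) ≤ E := by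
    intro c hc
    rw [hE, Real.exp_le_exp, neg_div, neg_le_neg_iff, div_eq_mul_one_div]
    exact mul_le_mul_of_nonneg_left hc (Nat.cast_nonneg T)
  have hr : r ∉ Finset.Iio r := by simp
  have b0 : P.real {ω | ¬ NearlyBalanced (fun t => D t ω) (7 / 100) ∅ (Finset.Iio r) r} ≤ 2 * E := by
    refine (hD.measureReal_not_nearlyBalanced (by norm_num) (by simp) (by simp) hr).trans ?_
    refine mul_le_mul_of_nonneg_left (hexp ?_) (by norm_num)
    rw [Finset.card_empty, zero_add, Fin.card_Iio, ← div_div]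
    gcongr
    exact le_one_sub_exp_neg (by norm_num) (by norm_num)
  -- Each of the other conditions concerns half of the leaf.
  have half : ∀ {I J : Finset (Fin N)} {j : Fin N}, Disjoint I J → j ∉ I → j ∉ J →
      I.card + J.card = r + 1 →
      P.real {ω | ¬ NearlyBalanced (fun t => D t ω) (1 / 10) I J j} ≤ 2 * E := by
    intro I J j hIJ hI hJ hc
    refine (hD.measureReal_not_nearlyBalanced (by norm_num) hIJ hI hJ).trans ?_
    refine mul_le_mul_of_nonneg_left (hexp ?_) (by norm_num)
    rw [hc, pow_succ' 2 (r : ℕ), ← div_div, ← div_div]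
    refine div_le_div_of_nonneg_right ?_ (by positivity)
    have : (2 / 113 : ℝ) ≤ 1 - Real.exp (-(2 * (1 / 10) ^ 2)) :=
      le_one_sub_exp_neg (by norm_num) (by norm_num)
    linarith
  have bj : ∀ j ∈ Finset.Ioi r, P.real
      ({ω | ¬ NearlyBalanced (fun t => D t ω) (1 / 10) ∅ (insert r (Finset.Iio r)) j} ∪
      ({ω | ¬ NearlyBalanced (fun t => D t ω) (1 / 10) {j} (Finset.Iio r) r} ∪
      {ω | ¬ NearlyBalanced (fun t => D t ω) (1 / 10) ∅ (insert j (Finset.Iio r)) r})) ≤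
        6 * E := by
    intro j hj
    rw [Finset.mem_Ioi] at hj
    have hj' : j ∉ Finset.Iio r := by simpa using hj.le
    have b1 := half (I := ∅) (J := insert r (Finset.Iio r)) (j := j) (by simp) (by simp)
      (by simpa using hj) (by rw [Finset.card_insert_of_notMem hr]; simp)
    have b2 := half (I := {j}) (J := Finset.Iio r) (j := r) (by simpa using hj.le)
      (by simpa using hj.ne) hr (by simp [add_comm])
    have b3 := half (I := ∅) (J := insert j (Finset.Iio r)) (j := r) (by simp) (by simp)
      (by simpa using hj.ne) (by rw [Finset.card_insert_of_notMem hj']; simp)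
    refine (measureReal_union_le _ _).trans ?_
    refine (add_le_add b1 ((measureReal_union_le _ _).trans (add_le_add b2 b3))).trans_eq ?_
    ring
  have hcard : ((Finset.Ioi r).card : ℝ) = (N : ℝ) - r - 1 := by
    rw [Fin.card_Ioi, Nat.sub_right_comm, Nat.cast_sub (by omega), Nat.cast_sub r.isLt.le]
    push_cast
    ring
  have hsum := (measureReal_biUnion_finset_le (μ := P) (Finset.Ioi r) _).trans
    (Finset.sum_le_sum bj)
  rw [Finset.sum_const, nsmul_eq_mul, hcard] at hsum
  refine (measureReal_mono fun ω hω => ?_).trans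
    ((measureReal_union_le _ _).trans ((add_le_add b0 hsum).trans_eq (by ring)))
  by_contra hcon
  simp only [Set.mem_union, Set.mem_iUnion, Set.mem_ofPred_eq, not_or, not_exists, not_not,
    Finset.mem_Ioi] at hcon
  exact hω ⟨hcon.1, fun j hj => hcon.2 j hj⟩

end Probability

theorem theorem4 (N T : ℕ) (ε : ℝ) (hε : (1 / 2 : ℝ) ^ N ≤ ε)
    {Ω : Type*} [MeasurableSpace Ω] (P : Measure Ω) [IsProbabilityMeasure P]
    (D : Fin T → Ω → Observation N) (hD : IsUniformTrainingData (rankingDCM N) P D)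
    (tree : Ω → DecisionTree N) (htree : Measurable tree)
    (hcart : ∀ᵐ ω ∂P, CartOutput (fun t => D t ω) 1 Finset.univ (tree ω)) :
    1 - ∑ i ∈ Finset.Icc 1 ⌈Real.logb 2 (1 / ε)⌉₊,
        (13 * Real.exp (-(T : ℝ) / (164 * 2 ^ (i - 1)))
          + 10 * ((N : ℝ) - i - 1) * Real.exp (-(T : ℝ) / (113 * 2 ^ (i - 1))))
      ≤ P.real {ω | (1 - ε) * 2 ^ N < (numCorrect (rankingDCM N) (tree ω) : ℝ)} := by
  have hε0 : 0 < ε := lt_of_lt_of_le (by positivity) hε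
  set k := ⌈Real.logb 2 (1 / ε)⌉₊ with hk
  have hkN : k ≤ N := by
    rw [hk, Nat.ceil_le, Real.logb_le_iff_le_rpow (by norm_num) (by positivity),
      Real.rpow_natCast, one_div_le hε0 (by positivity)]
    simpa using hε
  have hkε : (1 / 2 : ℝ) ^ k ≤ ε := by
    have h := Nat.le_ceil (Real.logb 2 (1 / ε))
    rw [← hk, Real.logb_le_iff_le_rpow (by norm_num) (by positivity),
      Real.rpow_natCast, one_div_le hε0 (by positivity)] at h
    simpa using h
  set G := {ω | (1 - ε) * 2 ^ N < (numCorrect (rankingDCM N) (tree ω) : ℝ)} with hG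
  let b : ℕ → Set Ω := fun m => {ω | ∃ r : Fin N, r.val = m ∧ ¬ Favourable (fun t => D t ω) r}
  have hcover : P.real Gᶜ ≤ P.real (⋃ m ∈ Finset.range k, b m) := by
    refine ENNReal.toReal_mono (measure_ne_top _ _) (measure_mono_ae ?_)
    filter_upwards [hcart, hD.ae_choice_eq] with ω h1 h2 hω
    by_contra hb
    refine hω (h1.lt_numCorrect h2 hkN (fun r hr => ?_) hkε)
    by_contra hr'
    exact hb (Set.mem_biUnion (Finset.mem_coe.2 (Finset.mem_range.2 hr)) ⟨r, rfl, hr'⟩)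
  have hb : ∀ m ∈ Finset.range k, P.real (b m) ≤
      13 * Real.exp (-(T : ℝ) / (164 * 2 ^ m)) +
        10 * ((N : ℝ) - (m + 1 : ℕ) - 1) * Real.exp (-(T : ℝ) / (113 * 2 ^ m)) := by
    intro m hm
    have hmN : m < N := (Finset.mem_range.1 hm).trans_le hkN
    have hbm : b m = {ω | ¬ Favourable (fun t => D t ω) ⟨m, hmN⟩} := by
      ext ω
      exact ⟨fun ⟨r, hr, h⟩ => by subst hr; exact h, fun h => ⟨⟨m, hmN⟩, rfl, h⟩⟩
    rw [hbm]
    refine (hD.measureReal_not_favourable ⟨m, hmN⟩).trans ?_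
    have hle : Real.exp (-(T : ℝ) / (113 * 2 ^ m)) ≤ Real.exp (-(T : ℝ) / (164 * 2 ^ m)) := by
      rw [Real.exp_le_exp, neg_div, neg_div, neg_le_neg_iff]
      gcongr
      norm_num
    have hpos := Real.exp_pos (-(T : ℝ) / (113 * 2 ^ m))
    have hmN' : (0 : ℝ) ≤ (N : ℝ) - m - 1 := by
      have : ((m + 1 : ℕ) : ℝ) ≤ N := by exact_mod_cast hmN
      push_cast at this
      linarith
    -- The term `13` pays for the factor `N - i - 1`, which is one less than the number of
    -- competing products and equals `-1` for the last product.
    have := mul_nonneg hmN' hpos.le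
    push_cast
    linarith
  have hsum : ∑ m ∈ Finset.range k, (13 * Real.exp (-(T : ℝ) / (164 * 2 ^ m)) +
        10 * ((N : ℝ) - (m + 1 : ℕ) - 1) * Real.exp (-(T : ℝ) / (113 * 2 ^ m))) =
      ∑ i ∈ Finset.Icc 1 k, (13 * Real.exp (-(T : ℝ) / (164 * 2 ^ (i - 1))) +
        10 * ((N : ℝ) - i - 1) * Real.exp (-(T : ℝ) / (113 * 2 ^ (i - 1)))) := by
    rw [← Finset.Ico_add_one_right_eq_Icc, Finset.sum_Ico_eq_sum_range]
    refine Finset.sum_congr (by simp) fun m _ => ?_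
    rw [Nat.add_comm 1 m, Nat.add_sub_cancel]
  have htot : 1 ≤ P.real G + P.real Gᶜ := by
    have := measureReal_union_le (μ := P) G Gᶜ
    rwa [Set.union_compl_self, probReal_univ] at this
  have := (measureReal_biUnion_finset_le (μ := P) _ b).trans (Finset.sum_le_sum hb)
  rw [hsum] at this
  linarith
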